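/- Let $d\in\mathbb N$, let $q\ge 2$ be real, let $\alpha\in(0,1)$, and equip $\mathbb R^d$ with the $\ell_q$ norm $\|\cdot\|$. A *structured object* over $\mathbb R^d$ is a triple $(X\times A,d_X,\mu)$, where $(X,d_X)$ is a compact metric space, $A\subset\mathbb R^d$ is compact, and $\mu$ is a Borel probability measure on $X\times A$ whose marginals on $X$ and on $A$ are fully supported. Let $H(\mathbb R^d)$ be the class of these objects. For two structured objects with measures $\mu$ on $X\times A$ and $\nu$ on $Y\times B$ let $\Pi(\mu,\nu)$ be the set of couplings of $\mu$ and $\nu$, and let $$d_{FGW}(\mu,\nu)=\inf_{\pi\in\Pi(\mu,\nu)}\int\!\!\int \Big((1-\alpha)\|a-b\|^q+\alpha\,|d_X(x,x')-d_Y(y,y')|^q\Big)\,d\pi((x,a),(y,b))\,d\pi((x',a'),(y',b'))$$ be the Fused Gromov-Wasserstein distance with exponents $p=1$ and $q$; a coupling attaining the infimum is called *optimal*. A *geodesic* in $H(\mathbb R^d)$ is a family $(\mathbb S_t)_{t\in[0,1]}$ of structured objects $\mathbb S_t=(X_t\times A_t,d_{X_t},\mu_t)$ that has constant speed for $d_{FGW}^{1/q}$,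 that is, $$d_{FGW}(\mu_t,\mu_s)^{1/q}\le |t-s|\,d_{FGW}(\mu_0,\mu_1)^{1/q}\qquad (s,t\in[0,1]).$$ **Theorem.** For every geodesic $(\mathbb S_t)_{t\in[0,1]}$ in $H(\mathbb R^d)$ there is an optimal coupling $\pi^*\in\Pi(\mu_0,\mu_1)$ such that for every $t\in[0,1]$ the object $\mathbb S_t$ is represented, up to equivalence, by $$\big(X_0\times X_1\times \hat A_t,\ (1-t)d_{X_0}\oplus t\,d_{X_1},\ \eta_t\#\pi^*\big),$$ where $\hat A_t=\{(1-t)a_0+ta_1 : a_0\in A_0,\ a_1\in A_1\}$, $\eta_t(x_0,a_0,x_1,a_1)=(x_0,x_1,(1-t)a_0+ta_1)$, and $\big((1-t)d_{X_0}\oplus t\,d_{X_1}\big)\big((x_0,x_1),(x_0',x_1')\big)=(1-t)d_{X_0}(x_0,x_0')+t\,d_{X_1}(x_1,x_1')$. Here a triple $(Y\times B,d_Y,\nu)$, where $d_Y$ may vanish off the diagonal and $\nu$ need not be fully supported, *represents* $(X\times A,d_X,\mu)$ up to equivalence if the support of the marginal of $\nu$ on $\mathbb R^d$ is contained in $B$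 and equal to $A$, and there is a measurable map $f_1:Y\to X$ whose restriction to the support of the marginal of $\nu$ on $Y$ is onto $X$ and preserves the distances, such that $(f_1\times \mathrm{id})\#\nu=\mu$. -/

import Mathlib

open MeasureTheory Set
open scoped ENNReal

universe u v

noncomputable section

namespace FGW

/-- A structured object over a metric space `Ω`: a compact metric space `X` (the structure), a
compact set `A` of features in `Ω`, and a Borel probability measure `μ` on `X × A` whose two
marginals are fully supported. The measure is regarded as a measure on `X × Ω`; as the support of
its second marginal is the compact set `A`, it is carried by `X × A`. -/
structure StructuredObject (Ω : Type v) [MetricSpace Ω] [MeasurableSpace Ω] where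
  X : Type u
  [metricSpace : MetricSpace X]
  [compactSpace : CompactSpace X]
  [measurableSpace : MeasurableSpace X]
  [borelSpace : BorelSpace X]
  A : Set Ω
  isCompact_A : IsCompact A
  μ : Measure (X × Ω)
  [isProbabilityMeasure : IsProbabilityMeasure μ]
  support_structure : μ.fst.support = univ
  support_feature : μ.snd.support = A

attribute [instance] StructuredObject.metricSpace StructuredObject.compactSpace
  StructuredObject.measurableSpace StructuredObject.borelSpace
  StructuredObject.isProbabilityMeasure

section Distance

variable {Ω : Type v} [MetricSpace Ω] [MeasurableSpace Ω]

/-- The couplings `Π(μ, ν)` of the measures of two structured objects. -/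
def couplings (S T : StructuredObject.{u} Ω) : Set (Measure ((S.X × Ω) × (T.X × Ω))) :=
  {π | π.fst = S.μ ∧ π.snd = T.μ}

/-- The transport cost
`E_{p,q,α}(π) = ∫∫ ((1-α) d(a,b)^q + α |d_X(x,x') - d_Y(y,y')|^q)^p dπ((x,a),(y,b)) dπ((x',a'),(y',b'))`,
with values in `[0, ∞]`. -/
def cost (α p q : ℝ) (S T : StructuredObject.{u} Ω) (π : Measure ((S.X × Ω) × (T.X × Ω))) :
    ℝ≥0∞ :=
  ∫⁻ z : ((S.X × Ω) × (T.X × Ω)) × ((S.X × Ω) × (T.X × Ω)),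
    ENNReal.ofReal (((1 - α) * dist z.1.1.2 z.1.2.2 ^ q +
      α * |dist z.1.1.1 z.2.1.1 - dist z.1.2.1 z.2.2.1| ^ q) ^ p) ∂(π.prod π)

/-- The Fused Gromov-Wasserstein distance `d_{FGW,α,p,q} = (inf_{π ∈ Π(μ,ν)} E_{p,q,α}(π))^{1/p}`. -/
def fgwDist (α p q : ℝ) (S T : StructuredObject.{u} Ω) : ℝ≥0∞ :=
  (⨅ π ∈ couplings S T, cost α p q S T π) ^ (1 / p)

/-- `π` is an optimal coupling of `S` and `T` for `d_{FGW,α,p,q}`. -/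
def IsOptimalCoupling (α p q : ℝ) (S T : StructuredObject.{u} Ω)
    (π : Measure ((S.X × Ω) × (T.X × Ω))) : Prop :=
  π ∈ couplings S T ∧ ∀ γ ∈ couplings S T, cost α p q S T π ≤ cost α p q S T γ

/-- The triple `(Y × B, dY, ν)`, where `dY` may vanish off the diagonal and `ν` need not be fully
supported, represents the structured object `S` up to equivalence: `ν` has its features in `B`,
and there is a map `f₁ : Y → S.X` whose restriction to the support of the structure marginal of `ν`
is onto and preserves the distances, such that `f₁ × id` maps `ν` to `S.μ`, the support of the
feature marginal of `ν` being the feature set of `S`. -/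
def IsRepresentedBy (S : StructuredObject.{u} Ω) {Y : Type u} [TopologicalSpace Y]
    [MeasurableSpace Y] (dY : Y → Y → ℝ) (B : Set Ω) (ν : Measure (Y × Ω)) : Prop :=
  ν.snd.support ⊆ B ∧ ν.snd.support = S.A ∧
    ∃ f₁ : Y → S.X, Measurable f₁ ∧
      f₁ '' ν.fst.support = univ ∧
      (∀ y ∈ ν.fst.support, ∀ y' ∈ ν.fst.support, dist (f₁ y) (f₁ y') = dY y y') ∧
      ν.map (Prod.map f₁ id) = S.μ

end Distance

/-- A curve `w : [0,1] → H` is a constant speed geodesic for the distance `D` if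
`D(w(t), w(s)) ≤ |t - s| D(w(0), w(1))` for all `s, t`. -/
def IsConstantSpeedGeodesic {H : Type*} (D : H → H → ℝ≥0∞) (w : unitInterval → H) : Prop :=
  ∀ t s : unitInterval, D (w t) (w s) ≤ ENNReal.ofReal |(t : ℝ) - s| * D (w 0) (w 1)

section Interpolation

/-- The function `(1-t) d_{X₀} ⊕ t d_{X₁}` on `X₀ × X₁`. -/
def interpDist {X₀ X₁ : Type*} [MetricSpace X₀] [MetricSpace X₁] (t : ℝ) (x y : X₀ × X₁) : ℝ :=
  (1 - t) * dist x.1 y.1 + t * dist x.2 y.2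

/-- The set `Â_t = {(1-t) a₀ + t a₁ | a₀ ∈ A₀, a₁ ∈ A₁}`. -/
def interpFeatures {E : Type*} [AddCommGroup E] [Module ℝ E] (A₀ A₁ : Set E) (t : ℝ) : Set E :=
  {a | ∃ a₀ ∈ A₀, ∃ a₁ ∈ A₁, (1 - t) • a₀ + t • a₁ = a}

/-- The map `η_t(x₀, a₀, x₁, a₁) = (x₀, x₁, (1-t) a₀ + t a₁)`. -/
def eta {X₀ X₁ E : Type*} [AddCommGroup E] [Module ℝ E] (t : ℝ) (z : (X₀ × E) × (X₁ × E)) :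
    (X₀ × X₁) × E :=
  ((z.1.1, z.2.1), (1 - t) • z.1.2 + t • z.2.2)

end Interpolation

instance fact_one_le_ofReal {q : ℝ} [hq : Fact (2 ≤ q)] : Fact (1 ≤ ENNReal.ofReal q) :=
  ⟨by rw [ENNReal.one_le_ofReal]; linarith [hq.out]⟩

/-- The space `ℝ^d` with the `ℓ_q` norm. -/
abbrev Lq (d : ℕ) (q : ℝ) : Type := PiLp (ENNReal.ofReal q) (fun _ : Fin d => ℝ)

end FGW

end

/-!
The `q`-th root of the transport cost of a coupling is an `L^q` norm: if `a` and `b` are random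
points of two objects on one probability space `(Θ, P)`, with `(x, a)`, `(y, b)` their coordinates,
it is the norm on `Θ × Θ` of the difference of the `ℓ_q`-valued functions
`((1-α)^{1/q} a, α^{1/q} d_X(x, x'))` and `((1-α)^{1/q} b, α^{1/q} d_Y(y, y'))`. Such norms satisfy
the triangle inequality, and since `q > 1` they are strictly convex. Both facts are consequences of
one scalar inequality, `abs_sub_rpow_le`, summed over coordinates and integrated: `cost_map_le` is
the triangle inequality, and `ae_eq_interp` its equality case, saying that a random point at cost
`t^q D` and `(1-t)^q D` from two points at cost at least `D` is almost surely their interpolation.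

For a finite set of times containing `0` and `1`, optimal couplings of consecutive times are glued
into one probability space (`exists_gluing`). By the triangle inequality, the coupling of the times
`0` and `1` so obtained is optimal, and for each `t` in the set it is the marginal of a joint law on
`S₀ × S₁ × S_t` with costs `t^q D` and `(1-t)^q D` (`interpPlans`). The set of couplings with
such an extension at a given time `t` is compact, being the image of the set of joint laws, which
is compact by Prokhorov's theorem and the lower semicontinuity of the cost. By the finite
intersection property one optimal coupling has such an extension at every time.

For a joint law `σ` of this kind the equality case gives `a_t = (1-t) a₀ + t a₁` and
`d_t(x_t, x_t') = (1-t) d₀(x₀, x₀') + t d₁(x₁, x₁')` almost surely, and the second relation holds by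
continuity on the whole support of the structure part of `σ`. Hence this support is the graph of a
distance preserving map `(x₀, x₁) ↦ x_t`, which is onto because the law of `x_t` is fully supported;
this is the map that represents `S_t` (`isRepresentedBy_of_ae_interp`).
-/

namespace FGW

/-! ### The equality case of the convexity inequality -/

theorem abs_sub_rpow_le {q l m : ℝ} (hq : 1 < q) (hl : 0 < l) (hm : 0 < m) (hlm : l + m = 1)
    (r s t : ℝ) :
    |r - t| ^ q ≤ l ^ (1 - q) * |r - s| ^ q + m ^ (1 - q) * |s - t| ^ q ∧
    (|r - t| ^ q = l ^ (1 - q) * |r - s| ^ q + m ^ (1 - q) * |s - t| ^ q →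
      s = m * r + l * t) := by
  have scale : ∀ {c : ℝ}, 0 < c → ∀ x : ℝ, c ^ (1 - q) * |x| ^ q = c * (|x| / c) ^ q := by
    intro c hc x
    rw [Real.div_rpow (abs_nonneg x) hc.le, Real.rpow_sub hc, Real.rpow_one]
    ring
  rw [scale hl, scale hm]
  set u := |r - s| / l with hu
  set v := |s - t| / m with hv
  have hu0 : 0 ≤ u := by positivity
  have hv0 : 0 ≤ v := by positivity
  have hlu : l * u = |r - s| := by rw [hu]; field_simp
  have hmv : m * v = |s - t| := by rw [hv]; field_simp
  have tri : |r - t| ≤ l * u + m * v := by rw [hlu, hmv]; exact abs_sub_le r s t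
  have hq0 : 0 < q := by linarith
  have mono : |r - t| ^ q ≤ (l * u + m * v) ^ q := by gcongr
  have conv : (l * u + m * v) ^ q ≤ l * u ^ q + m * v ^ q := by
    simpa using (convexOn_rpow hq.le).2 (x := u) (y := v) hu0 hv0 hl.le hm.le hlm
  refine ⟨mono.trans conv, fun h => ?_⟩
  have huv : u = v := by
    by_contra hne
    have : (l * u + m * v) ^ q < l * u ^ q + m * v ^ q := by
      simpa using (strictConvexOn_rpow hq).2 (x := u) (y := v) hu0 hv0 hne hl hm hlm
    linarith
  have habs : |r - t| = l * u + m * v := by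
    refine (Real.rpow_left_inj (abs_nonneg _) (by positivity) hq0.ne').1 ?_
    linarith
  -- equality in the triangle inequality excludes opposite signs of `r - s` and `s - t`
  have hsum : |(r - s) + (s - t)| = |r - s| + |s - t| := by
    rw [sub_add_sub_cancel, habs, hlu, hmv]
  have key : m * |r - s| = l * |s - t| := by rw [← hlu, ← hmv, huv]; ring
  have : m * (r - s) = l * (s - t) := by
    rcases abs_add_eq_add_abs_iff _ _ |>.1 hsum with ⟨h1, h2⟩ | ⟨h1, h2⟩
    · rwa [abs_of_nonneg h1, abs_of_nonneg h2] at key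
    · rw [abs_of_nonpos h1, abs_of_nonpos h2] at key; linarith
  have e : l = 1 - m := by linarith
  subst e
  linarith

theorem dist_rpow_eq_sum {d : ℕ} {q : ℝ} [hq : Fact (2 ≤ q)] (a b : Lq d q) :
    dist a b ^ q = ∑ i, |a i - b i| ^ q := by
  have hq0 : 0 < q := by linarith [hq.out]
  have h : (ENNReal.ofReal q).toReal = q := ENNReal.toReal_ofReal hq0.le
  rw [PiLp.dist_eq_sum (by rw [h]; exact hq0), h, ← Real.rpow_mul (by positivity)]
  simp [hq0.ne', Real.dist_eq]

theorem dist_rpow_le {d : ℕ} {q l m : ℝ} [hq : Fact (2 ≤ q)] (hl : 0 < l) (hm : 0 < m)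
    (hlm : l + m = 1) (a b c : Lq d q) :
    dist a c ^ q ≤ l ^ (1 - q) * dist a b ^ q + m ^ (1 - q) * dist b c ^ q ∧
    (dist a c ^ q = l ^ (1 - q) * dist a b ^ q + m ^ (1 - q) * dist b c ^ q →
      b = m • a + l • c) := by
  have hq1 : 1 < q := by linarith [hq.out]
  simp only [dist_rpow_eq_sum, Finset.mul_sum, ← Finset.sum_add_distrib]
  refine ⟨Finset.sum_le_sum fun i _ => (abs_sub_rpow_le hq1 hl hm hlm _ _ _).1, fun h => ?_⟩
  rw [Finset.sum_eq_sum_iff_of_le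
    (fun i _ => (abs_sub_rpow_le hq1 hl hm hlm (a i) (b i) (c i)).1)] at h
  ext i
  simpa using (abs_sub_rpow_le hq1 hl hm hlm _ _ _).2 (h i (Finset.mem_univ i))

section Integrand

variable {d : ℕ} {q : ℝ} [hq : Fact (2 ≤ q)] {X Y Z : Type*} [MetricSpace X] [MetricSpace Y]
  [MetricSpace Z]

/-- The integrand `(1-α) d(a,b)^q + α |d_X(x,x') - d_Y(y,y')|^q` of the transport cost, as a
function of the points `((x,a),(y,b))` and `((x',a'),(y',b'))`. -/
noncomputable def integrand (α : ℝ) (u v : (X × Lq d q) × (Y × Lq d q)) : ℝ :=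
  (1 - α) * dist u.1.2 u.2.2 ^ q + α * |dist u.1.1 v.1.1 - dist u.2.1 v.2.1| ^ q

theorem integrand_nonneg {α : ℝ} (hα : α ∈ Ioo (0 : ℝ) 1) (u v : (X × Lq d q) × (Y × Lq d q)) :
    0 ≤ integrand α u v := by
  have h1 := hα.1
  have h2 : 0 < 1 - α := sub_pos.2 hα.2
  unfold integrand
  positivity

theorem integrand_self (α : ℝ) (x x' : X × Lq d q) : integrand α (x, x) (x', x') = 0 := by
  have hq0 : q ≠ 0 := by linarith [hq.out]
  simp [integrand, Real.zero_rpow hq0]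

theorem integrand_eq_zero {α : ℝ} (hα : α ∈ Ioo (0 : ℝ) 1) {u v : (X × Lq d q) × (Y × Lq d q)}
    (h : integrand α u v = 0) : u.1.2 = u.2.2 ∧ dist u.1.1 v.1.1 = dist u.2.1 v.2.1 := by
  have hq0 : q ≠ 0 := by linarith [hq.out]
  have h1 := hα.1
  have h2 : 0 < 1 - α := sub_pos.2 hα.2
  unfold integrand at h
  rw [add_eq_zero_iff_of_nonneg (by positivity) (by positivity)] at h
  constructor
  · have := h.1
    simpa [h2.ne', Real.rpow_eq_zero, hq0] using this
  · have := h.2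
    simpa [h1.ne', Real.rpow_eq_zero, hq0, sub_eq_zero] using this

theorem continuous_integrand (α : ℝ) :
    Continuous fun z : ((X × Lq d q) × (Y × Lq d q)) × ((X × Lq d q) × (Y × Lq d q)) =>
      integrand α z.1 z.2 := by
  have hq0 : 0 ≤ q := by linarith [hq.out]
  unfold integrand
  refine .add (.mul continuous_const (.rpow_const (by fun_prop) fun _ => .inr hq0))
    (.mul continuous_const (.rpow_const (by fun_prop) fun _ => .inr hq0))

theorem integrand_le {α l m : ℝ} (hα : α ∈ Ioo (0 : ℝ) 1) (hl : 0 < l) (hm : 0 < m)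
    (hlm : l + m = 1) (x x' : X × Lq d q) (y y' : Y × Lq d q) (z z' : Z × Lq d q) :
    integrand α (x, z) (x', z') ≤
        l ^ (1 - q) * integrand α (x, y) (x', y') + m ^ (1 - q) * integrand α (y, z) (y', z') ∧
      (integrand α (x, z) (x', z') =
        l ^ (1 - q) * integrand α (x, y) (x', y') + m ^ (1 - q) * integrand α (y, z) (y', z') →
        y.2 = m • x.2 + l • z.2 ∧
        dist y.1 y'.1 = m * dist x.1 x'.1 + l * dist z.1 z'.1) := by
  have hq1 : 1 < q := by linarith [hq.out]
  have h1 := hα.1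
  have h2 : 0 < 1 - α := sub_pos.2 hα.2
  obtain ⟨hA, hA'⟩ := dist_rpow_le hl hm hlm x.2 y.2 z.2
  obtain ⟨hB, hB'⟩ := abs_sub_rpow_le hq1 hl hm hlm (dist x.1 x'.1) (dist y.1 y'.1) (dist z.1 z'.1)
  have hA₁ := mul_le_mul_of_nonneg_left hA h2.le
  have hB₁ := mul_le_mul_of_nonneg_left hB h1.le
  simp only [integrand]
  refine ⟨by linarith, fun h => ⟨hA' ?_, hB' ?_⟩⟩
  · exact mul_left_cancel₀ h2.ne' (by linarith)
  · exact mul_left_cancel₀ h1.ne' (by linarith)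

end Integrand

/-! ### Weak convergence, tightness and supports -/

section Topology

open scoped NNReal

variable {E F : Type*} [TopologicalSpace E] [MeasurableSpace E] [TopologicalSpace F]
  [MeasurableSpace F]

theorem isTightMeasureSet_setOf_fst_snd {M : Set (Measure E)} {N : Set (Measure F)}
    (hM : IsTightMeasureSet M) (hN : IsTightMeasureSet N) :
    IsTightMeasureSet {π : Measure (E × F) | π.fst ∈ M ∧ π.snd ∈ N} := by
  refine .prodMk (hM.subset ?_) (hN.subset ?_)
  · rintro _ ⟨π, hπ, rfl⟩; exact hπ.1
  · rintro _ ⟨π, hπ, rfl⟩; exact hπ.2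

/-- A closed condition on pairs that holds almost surely for two independent points holds on the
support. -/
theorem mem_of_mem_support_of_ae_prod {μ : Measure E} [SFinite μ] {C : Set (E × E)}
    (hC : IsClosed C) (h : ∀ᵐ z ∂μ.prod μ, z ∈ C) {x y : E} (hx : x ∈ μ.support)
    (hy : y ∈ μ.support) : (x, y) ∈ C := by
  by_contra hxy
  obtain ⟨U, hU, V, hV, hUV⟩ := mem_nhds_prod_iff.1 (hC.isOpen_compl.mem_nhds hxy)
  have h0 : (μ.prod μ) (U ×ˢ V) = 0 := measure_mono_null hUV h
  rw [Measure.prod_prod, mul_eq_zero] at h0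
  rw [Measure.mem_support_iff_forall] at hx hy
  exact h0.elim (hx U hU).ne' (hy V hV).ne'

variable [BorelSpace E] [BorelSpace F]

theorem lowerSemicontinuous_lintegral_ofReal {f : E → ℝ} (hf : Continuous f) :
    LowerSemicontinuous fun μ : ProbabilityMeasure E =>
      ∫⁻ x, ENNReal.ofReal (f x) ∂(μ : Measure E) := by
  -- the truncations `min f n` are bounded, and their integrals depend continuously on `μ`
  let g : ℕ → BoundedContinuousFunction E ℝ≥0 := fun n =>
    BoundedContinuousFunction.mkOfBound
      ⟨fun x => min (f x).toNNReal (n : ℝ≥0),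
        (continuous_real_toNNReal.comp hf).min continuous_const⟩ n fun x y => by
          rw [NNReal.dist_eq, abs_le]
          have h1 : ((min (f x).toNNReal (n : ℝ≥0) : ℝ≥0) : ℝ) ≤ n := by
            exact_mod_cast min_le_right _ _
          have h2 : ((min (f y).toNNReal (n : ℝ≥0) : ℝ≥0) : ℝ) ≤ n := by
            exact_mod_cast min_le_right _ _
          have h3 := NNReal.coe_nonneg (min (f x).toNNReal (n : ℝ≥0))
          have h4 := NNReal.coe_nonneg (min (f y).toNNReal (n : ℝ≥0))
          simp only [ContinuousMap.coe_mk]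
          constructor <;> linarith
  have hg : ∀ n x, (g n x : ℝ≥0∞) = min (ENNReal.ofReal (f x)) n := by
    intro n x
    change ((min (f x).toNNReal (n : ℝ≥0) : ℝ≥0) : ℝ≥0∞) = _
    rw [ENNReal.coe_min]
    rfl
  have hsup : ∀ μ : ProbabilityMeasure E, ∫⁻ x, ENNReal.ofReal (f x) ∂(μ : Measure E) =
      ⨆ n, ∫⁻ x, g n x ∂(μ : Measure E) := by
    intro μ
    rw [← lintegral_iSup]
    · refine lintegral_congr fun x => le_antisymm ?_ (iSup_le fun n => ?_)
      · obtain ⟨n, hn⟩ := ENNReal.exists_nat_gt (ENNReal.ofReal_ne_top (r := f x))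
        refine le_iSup_of_le n ?_
        rw [hg, min_eq_left hn.le]
      · rw [hg]; exact min_le_left _ _
    · exact fun n => (g n).continuous.measurable.coe_nnreal_ennreal
    · intro n m hnm x
      simp only [hg]
      exact min_le_min_left _ (by exact_mod_cast hnm)
  simp only [hsup]
  exact lowerSemicontinuous_iSup fun n =>
    (ProbabilityMeasure.continuous_lintegral_boundedContinuousFunction (g n)).lowerSemicontinuous

theorem lowerSemicontinuous_lintegral_prod_self [SecondCountableTopology E]
    [TopologicalSpace.PseudoMetrizableSpace E] {f : E × E → ℝ} (hf : Continuous f) :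
    LowerSemicontinuous fun μ : ProbabilityMeasure E =>
      ∫⁻ z, ENNReal.ofReal (f z) ∂(μ : Measure E).prod (μ : Measure E) :=
  (lowerSemicontinuous_lintegral_ofReal hf).comp (g := fun μ : ProbabilityMeasure E => μ.prod μ)
    (ProbabilityMeasure.continuous_prod.comp (continuous_id.prodMk continuous_id))

theorem isClosed_setOf_map_eq [HasOuterApproxClosed F] {f : E → F} (hf : Continuous f)
    (μ : Measure F) [IsProbabilityMeasure μ] :
    IsClosed {π : ProbabilityMeasure E | (π : Measure E).map f = μ} := by
  have : {π : ProbabilityMeasure E | (π : Measure E).map f = μ} =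
      (fun π : ProbabilityMeasure E => π.map hf.measurable.aemeasurable) ⁻¹'
        {(⟨μ, inferInstance⟩ : ProbabilityMeasure F)} := by
    ext π
    exact ⟨fun h => Subtype.ext h, fun h => congrArg Subtype.val h⟩
  rw [this]
  exact isClosed_singleton.preimage (ProbabilityMeasure.continuous_map hf)

theorem isCompact_of_isTight_of_isClosed [T2Space E] {K : Set (ProbabilityMeasure E)}
    (hK : IsClosed K) {M : Set (Measure E)} (hM : IsTightMeasureSet M)
    (hKM : ∀ π ∈ K, (π : Measure E) ∈ M) : IsCompact K := by
  rw [← hK.closure_eq]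
  refine isCompact_closure_of_isTightMeasureSet (hM.subset ?_)
  rintro _ ⟨π, hπ, rfl⟩
  exact hKM π hπ

theorem support_map [HereditarilyLindelofSpace E] [CompactSpace E] [T2Space F] (μ : Measure E)
    {f : E → F} (hf : Continuous f) : (μ.map f).support = f '' μ.support := by
  apply subset_antisymm
  · have hc : IsClosed (f '' μ.support) :=
      (Measure.isClosed_support.isCompact.image hf).isClosed
    refine Measure.support_subset_of_isClosed hc ?_
    rw [mem_ae_map_iff hf.aemeasurable hc.measurableSet]
    filter_upwards [Measure.support_mem_ae (μ := μ)] with x hx using mem_image_of_mem f hx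
  · rintro _ ⟨x, hx, rfl⟩
    rw [Measure.mem_support_iff_forall] at hx ⊢
    intro U hU
    exact (hx _ (hf.continuousAt hU)).trans_le (Measure.le_map_apply hf.aemeasurable U)

end Topology

/-! ### Gluing -/

/-- A random variable `Z` with law the first marginal of `π` extends, on a larger probability
space, to a pair of law `π`: the second variable is drawn from the disintegration of `π` given
the value of `Z`. -/
theorem exists_extension {Θ E F : Type*} [MeasurableSpace Θ] [MeasurableSpace E]
    [MeasurableSpace F] [StandardBorelSpace F] [Nonempty F] (P : Measure Θ)
    [IsProbabilityMeasure P] {Z : Θ → E} (hZ : Measurable Z) (π : Measure (E × F))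
    [IsFiniteMeasure π] (hπ : π.fst = P.map Z) :
    ∃ P' : Measure (Θ × F), IsProbabilityMeasure P' ∧ P'.fst = P ∧
      P'.map (Prod.map Z id) = π := by
  refine ⟨P.compProd (π.condKernel.comap Z hZ), inferInstance, Measure.fst_compProd _ _, ?_⟩
  conv_rhs => rw [← π.disintegrate π.condKernel, hπ]
  have : IsProbabilityMeasure (P.map Z) := Measure.isProbabilityMeasure_map hZ.aemeasurable
  refine Measure.ext_prod fun {s t} hs ht => ?_
  rw [Measure.map_apply (hZ.prodMap measurable_id) (hs.prod ht), preimage_prod_map_prod,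
    Measure.compProd_apply_prod (hZ hs) (measurable_id ht), Measure.compProd_apply_prod hs ht,
    setLIntegral_map hs (ProbabilityTheory.Kernel.measurable_coe _ ht) hZ]
  rfl

/-! ### The cost of a pair of random points -/

section Cost

variable {d : ℕ} {q : ℝ} [hq : Fact (2 ≤ q)] {α : ℝ} {S T R : StructuredObject.{u} (Lq d q)}

theorem cost_eq_lintegral_integrand (α : ℝ) (S T : StructuredObject.{u} (Lq d q))
    (π : Measure ((S.X × Lq d q) × (T.X × Lq d q))) :
    cost α 1 q S T π = ∫⁻ z, ENNReal.ofReal (integrand α z.1 z.2) ∂π.prod π := by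
  simp [cost, integrand]

variable {Θ : Type*} [MeasurableSpace Θ] {P : Measure Θ} [IsProbabilityMeasure P]
  {a : Θ → S.X × Lq d q} {b : Θ → T.X × Lq d q} {c : Θ → R.X × Lq d q}

theorem measurable_ofReal_integrand (α : ℝ) (ha : Measurable a) (hb : Measurable b) :
    Measurable fun z : Θ × Θ =>
      ENNReal.ofReal (integrand α (a z.1, b z.1) (a z.2, b z.2)) :=
  (ENNReal.measurable_ofReal.comp (continuous_integrand (q := q) α).measurable).comp
    (f := fun z : Θ × Θ => ((a z.1, b z.1), (a z.2, b z.2))) (by fun_prop)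

theorem cost_map (α : ℝ) (ha : Measurable a) (hb : Measurable b) :
    cost α 1 q S T (P.map fun ω => (a ω, b ω)) =
      ∫⁻ z, ENNReal.ofReal (integrand α (a z.1, b z.1) (a z.2, b z.2)) ∂P.prod P := by
  have hab : Measurable fun ω => (a ω, b ω) := ha.prodMk hb
  rw [cost_eq_lintegral_integrand, Measure.map_prod_map P P hab hab, lintegral_map]
  · rfl
  · exact ENNReal.measurable_ofReal.comp (continuous_integrand (q := q) α).measurable
  · exact hab.prodMap hab

theorem cost_map_self (α : ℝ) (ha : Measurable a) :
    cost α 1 q S S (P.map fun ω => (a ω, a ω)) = 0 := by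
  rw [cost_map α ha ha]
  simp [integrand_self]

theorem ofReal_integrand_le (hα : α ∈ Ioo (0 : ℝ) 1) {l m : ℝ} (hl : 0 < l) (hm : 0 < m)
    (hlm : l + m = 1) (x x' : S.X × Lq d q) (y y' : T.X × Lq d q) (z z' : R.X × Lq d q) :
    ENNReal.ofReal (integrand α (x, z) (x', z')) ≤
      ENNReal.ofReal (l ^ (1 - q)) * ENNReal.ofReal (integrand α (x, y) (x', y')) +
        ENNReal.ofReal (m ^ (1 - q)) * ENNReal.ofReal (integrand α (y, z) (y', z')) := by
  have hl' : 0 ≤ l ^ (1 - q) := by positivity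
  have hm' : 0 ≤ m ^ (1 - q) := by positivity
  rw [← ENNReal.ofReal_mul hl', ← ENNReal.ofReal_mul hm',
    ← ENNReal.ofReal_add (mul_nonneg hl' (integrand_nonneg hα _ _))
      (mul_nonneg hm' (integrand_nonneg hα _ _))]
  exact ENNReal.ofReal_le_ofReal (integrand_le hα hl hm hlm x x' y y' z z').1

theorem lintegral_add_integrand (α : ℝ) (ha : Measurable a) (hb : Measurable b)
    (hc : Measurable c) (l m : ℝ≥0∞) :
    ∫⁻ z, (l * ENNReal.ofReal (integrand α (a z.1, b z.1) (a z.2, b z.2)) +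
        m * ENNReal.ofReal (integrand α (b z.1, c z.1) (b z.2, c z.2))) ∂P.prod P =
      l * cost α 1 q S T (P.map fun ω => (a ω, b ω)) +
        m * cost α 1 q T R (P.map fun ω => (b ω, c ω)) := by
  have h1 := measurable_ofReal_integrand α ha hb
  have h2 := measurable_ofReal_integrand α hb hc
  rw [cost_map α ha hb, cost_map α hb hc, lintegral_add_left (h1.const_mul _),
    lintegral_const_mul _ h1, lintegral_const_mul _ h2]

/-- The triangle inequality for the `q`-th root of the cost, along variables whose distances are
bounded by the lengths of consecutive intervals. -/
theorem cost_map_le (hα : α ∈ Ioo (0 : ℝ) 1) (ha : Measurable a) (hb : Measurable b)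
    (hc : Measurable c) {h k : ℝ} (hh : 0 < h) (hk : 0 < k) {D : ℝ≥0∞}
    (hab : cost α 1 q S T (P.map fun ω => (a ω, b ω)) ≤ ENNReal.ofReal (h ^ q) * D)
    (hbc : cost α 1 q T R (P.map fun ω => (b ω, c ω)) ≤ ENNReal.ofReal (k ^ q) * D) :
    cost α 1 q S R (P.map fun ω => (a ω, c ω)) ≤ ENNReal.ofReal ((h + k) ^ q) * D := by
  have hl : 0 < h / (h + k) := by positivity
  have hm : 0 < k / (h + k) := by positivity
  have hlm : h / (h + k) + k / (h + k) = 1 := by field_simp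
  have hscale : ∀ {x : ℝ}, 0 < x →
      (x / (h + k)) ^ (1 - q) * x ^ q = x * (h + k) ^ (q - 1) := by
    intro x hx
    have : (h + k) ^ (q - 1) * (h + k) ^ (1 - q) = 1 := by
      rw [← Real.rpow_add (by positivity)]; simp
    rw [Real.div_rpow hx.le (by positivity), Real.rpow_sub hx, Real.rpow_one]
    have h1 : 0 < (h + k) ^ (1 - q) := by positivity
    field_simp
    linarith
  calc cost α 1 q S R (P.map fun ω => (a ω, c ω))
      ≤ ENNReal.ofReal ((h / (h + k)) ^ (1 - q)) * cost α 1 q S T (P.map fun ω => (a ω, b ω)) +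
        ENNReal.ofReal ((k / (h + k)) ^ (1 - q)) *
          cost α 1 q T R (P.map fun ω => (b ω, c ω)) := by
        rw [← lintegral_add_integrand α ha hb hc, cost_map α ha hc]
        exact lintegral_mono fun z => ofReal_integrand_le hα hl hm hlm _ _ _ _ _ _
    _ ≤ ENNReal.ofReal ((h / (h + k)) ^ (1 - q)) * (ENNReal.ofReal (h ^ q) * D) +
        ENNReal.ofReal ((k / (h + k)) ^ (1 - q)) * (ENNReal.ofReal (k ^ q) * D) := by gcongr
    _ = ENNReal.ofReal ((h + k) ^ q) * D := by
        rw [← mul_assoc, ← mul_assoc, ← add_mul, ← ENNReal.ofReal_mul (by positivity),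
          ← ENNReal.ofReal_mul (by positivity), hscale hh, hscale hk,
          ← ENNReal.ofReal_add (by positivity) (by positivity), ← add_mul,
          Real.rpow_sub (by positivity), Real.rpow_one]
        congr 2
        field_simp

/-- Equality in the triangle inequality at the time `t`: the intermediate point is almost surely
the interpolation of the two end points, for the features and for the structure distances. -/
theorem ae_eq_interp (hα : α ∈ Ioo (0 : ℝ) 1) (ha : Measurable a) (hb : Measurable b)
    (hc : Measurable c) {t : ℝ} (ht : t ∈ Icc (0 : ℝ) 1) {D : ℝ≥0∞} (hD : D ≠ ∞)
    (hab : cost α 1 q S T (P.map fun ω => (a ω, b ω)) ≤ ENNReal.ofReal (t ^ q) * D)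
    (hbc : cost α 1 q T R (P.map fun ω => (b ω, c ω)) ≤ ENNReal.ofReal ((1 - t) ^ q) * D)
    (hac : D ≤ cost α 1 q S R (P.map fun ω => (a ω, c ω))) :
    ∀ᵐ z ∂P.prod P, (b z.1).2 = (1 - t) • (a z.1).2 + t • (c z.1).2 ∧
      dist (b z.1).1 (b z.2).1 =
        (1 - t) * dist (a z.1).1 (a z.2).1 + t * dist (c z.1).1 (c z.2).1 := by
  have hq0 : q ≠ 0 := by linarith [hq.out]
  have hzero : ∀ x : ℝ≥0∞, x ≤ ENNReal.ofReal ((0 : ℝ) ^ q) * D → x = 0 := by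
    intro x hx
    simpa [Real.zero_rpow hq0] using hx
  rcases ht.1.eq_or_lt with rfl | ht0
  · have h0 := hzero _ hab
    rw [cost_map α ha hb, lintegral_eq_zero_iff (measurable_ofReal_integrand α ha hb)] at h0
    filter_upwards [h0] with z hz
    obtain ⟨e₁, e₂⟩ : (a z.1).2 = (b z.1).2 ∧
        dist (a z.1).1 (a z.2).1 = dist (b z.1).1 (b z.2).1 :=
      integrand_eq_zero hα
        (le_antisymm (ENNReal.ofReal_eq_zero.1 hz) (integrand_nonneg hα _ _))
    simp [e₁, e₂]
  rcases ht.2.eq_or_lt with rfl | ht1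
  · rw [sub_self] at hbc
    have h0 := hzero _ hbc
    rw [cost_map α hb hc, lintegral_eq_zero_iff (measurable_ofReal_integrand α hb hc)] at h0
    filter_upwards [h0] with z hz
    obtain ⟨e₁, e₂⟩ : (b z.1).2 = (c z.1).2 ∧
        dist (b z.1).1 (b z.2).1 = dist (c z.1).1 (c z.2).1 :=
      integrand_eq_zero hα
        (le_antisymm (ENNReal.ofReal_eq_zero.1 hz) (integrand_nonneg hα _ _))
    simp [e₁, e₂]
  have ht1' : 0 < 1 - t := sub_pos.2 ht1
  have hlm : t + (1 - t) = 1 := by ring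
  have hscale : ∀ {x : ℝ}, 0 < x → x ^ (1 - q) * x ^ q = x := by
    intro x hx
    rw [← Real.rpow_add hx]; simp
  have hle : ∫⁻ z, (ENNReal.ofReal (t ^ (1 - q)) *
          ENNReal.ofReal (integrand α (a z.1, b z.1) (a z.2, b z.2)) +
        ENNReal.ofReal ((1 - t) ^ (1 - q)) *
          ENNReal.ofReal (integrand α (b z.1, c z.1) (b z.2, c z.2))) ∂P.prod P ≤ D := by
    rw [lintegral_add_integrand α ha hb hc]
    calc _ ≤ ENNReal.ofReal (t ^ (1 - q)) * (ENNReal.ofReal (t ^ q) * D) +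
          ENNReal.ofReal ((1 - t) ^ (1 - q)) * (ENNReal.ofReal ((1 - t) ^ q) * D) := by gcongr
      _ = D := by
        rw [← mul_assoc, ← mul_assoc, ← add_mul, ← ENNReal.ofReal_mul (by positivity),
          ← ENNReal.ofReal_mul (by positivity), hscale ht0, hscale ht1',
          ← ENNReal.ofReal_add ht0.le ht1'.le, hlm]
        simp
  rw [cost_map α ha hc] at hac
  have hmono : ∀ z : Θ × Θ, _ := fun z => ofReal_integrand_le hα ht0 ht1' hlm
    (a z.1) (a z.2) (b z.1) (b z.2) (c z.1) (c z.2)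
  have heq := ae_eq_of_ae_le_of_lintegral_le (μ := P.prod P) (.of_forall hmono)
    (ne_top_of_le_ne_top hD ((lintegral_mono hmono).trans hle))
    (((measurable_ofReal_integrand α ha hb).const_mul _).add
      ((measurable_ofReal_integrand α hb hc).const_mul _)).aemeasurable (hle.trans hac)
  filter_upwards [heq] with z hz
  have hl' : 0 ≤ t ^ (1 - q) := by positivity
  have hm' : 0 ≤ (1 - t) ^ (1 - q) := by positivity
  have i1 := mul_nonneg hl' (integrand_nonneg hα (a z.1, b z.1) (a z.2, b z.2))
  have i2 := mul_nonneg hm' (integrand_nonneg hα (b z.1, c z.1) (b z.2, c z.2))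
  rw [← ENNReal.ofReal_mul hl', ← ENNReal.ofReal_mul hm', ← ENNReal.ofReal_add i1 i2,
    ENNReal.ofReal_eq_ofReal_iff (integrand_nonneg hα _ _) (add_nonneg i1 i2)] at hz
  exact (integrand_le hα ht0 ht1' hlm _ _ _ _ _ _).2 hz

end Cost

/-! ### Optimal couplings and gluing along finitely many times -/

section Optimal

variable {d : ℕ} {q : ℝ} [hq : Fact (2 ≤ q)] {α : ℝ} {S T R : StructuredObject.{u} (Lq d q)}

theorem isProbabilityMeasure_of_mem_couplings {π : Measure ((S.X × Lq d q) × (T.X × Lq d q))}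
    (hπ : π ∈ couplings S T) : IsProbabilityMeasure π := by
  refine ⟨?_⟩
  rw [← Measure.fst_univ, hπ.1]
  exact measure_univ

theorem map_mem_couplings {Θ : Type*} [MeasurableSpace Θ] {P : Measure Θ}
    {a : Θ → S.X × Lq d q} {b : Θ → T.X × Lq d q} (ha : Measurable a) (hb : Measurable b)
    (hPa : P.map a = S.μ) (hPb : P.map b = T.μ) :
    P.map (fun ω => (a ω, b ω)) ∈ couplings S T :=
  ⟨(Measure.fst_map_prodMk hb).trans hPa, (Measure.snd_map_prodMk ha).trans hPb⟩

theorem prod_mem_couplings (S T : StructuredObject.{u} (Lq d q)) :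
    S.μ.prod T.μ ∈ couplings S T :=
  ⟨Measure.fst_prod, Measure.snd_prod⟩

theorem isTightMeasureSet_couplings (S T : StructuredObject.{u} (Lq d q)) :
    IsTightMeasureSet (couplings S T) :=
  (isTightMeasureSet_setOf_fst_snd (M := {S.μ}) (N := {T.μ}) isTightMeasureSet_singleton
    isTightMeasureSet_singleton).subset fun _ h => h

theorem isClosed_couplings (S T : StructuredObject.{u} (Lq d q)) :
    IsClosed {π : ProbabilityMeasure ((S.X × Lq d q) × (T.X × Lq d q)) |
      (π : Measure _) ∈ couplings S T} :=
  (isClosed_setOf_map_eq continuous_fst S.μ).inter (isClosed_setOf_map_eq continuous_snd T.μ)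

theorem isCompact_couplings (S T : StructuredObject.{u} (Lq d q)) :
    IsCompact {π : ProbabilityMeasure ((S.X × Lq d q) × (T.X × Lq d q)) |
      (π : Measure _) ∈ couplings S T} :=
  isCompact_of_isTight_of_isClosed (isClosed_couplings S T) (isTightMeasureSet_couplings S T)
    fun _ h => h

theorem lowerSemicontinuous_cost (α : ℝ) (S T : StructuredObject.{u} (Lq d q)) :
    LowerSemicontinuous fun π : ProbabilityMeasure ((S.X × Lq d q) × (T.X × Lq d q)) =>
      cost α 1 q S T π := by
  simp only [cost_eq_lintegral_integrand]
  exact lowerSemicontinuous_lintegral_prod_self (continuous_integrand α)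

theorem isClosed_setOf_cost_map_le {E : Type*} [TopologicalSpace E] [MeasurableSpace E]
    [BorelSpace E] (α : ℝ) {a : E → S.X × Lq d q} {b : E → T.X × Lq d q} (ha : Continuous a)
    (hb : Continuous b) (D : ℝ≥0∞) :
    IsClosed {σ : ProbabilityMeasure E |
      cost α 1 q S T ((σ : Measure E).map fun z => (a z, b z)) ≤ D} :=
  ((lowerSemicontinuous_cost α S T).comp
    (ProbabilityMeasure.continuous_map (ha.prodMk hb))).isClosed_preimage D

theorem exists_isOptimalCoupling (α : ℝ) (S T : StructuredObject.{u} (Lq d q)) :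
    ∃ π, IsOptimalCoupling α 1 q S T π := by
  obtain ⟨π, hπ, hmin⟩ := LowerSemicontinuousOn.exists_isMinOn
    ⟨⟨S.μ.prod T.μ, inferInstance⟩, prod_mem_couplings S T⟩ (isCompact_couplings S T)
    ((lowerSemicontinuous_cost α S T).lowerSemicontinuousOn _)
  refine ⟨π, hπ, fun γ hγ => ?_⟩
  have := isProbabilityMeasure_of_mem_couplings hγ
  exact hmin (show (⟨γ, this⟩ : ProbabilityMeasure _) ∈ _ from hγ)

theorem fgwDist_eq_cost {π : Measure ((S.X × Lq d q) × (T.X × Lq d q))}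
    (hπ : IsOptimalCoupling α 1 q S T π) : fgwDist α 1 q S T = cost α 1 q S T π := by
  simp only [fgwDist, div_one, ENNReal.rpow_one]
  exact le_antisymm (iInf₂_le π hπ.1) (le_iInf₂ hπ.2)

theorem fgwDist_le_cost {π : Measure ((S.X × Lq d q) × (T.X × Lq d q))}
    (hπ : π ∈ couplings S T) : fgwDist α 1 q S T ≤ cost α 1 q S T π := by
  simp only [fgwDist, div_one, ENNReal.rpow_one]
  exact iInf₂_le π hπ

theorem ae_mem_features (S : StructuredObject.{u} (Lq d q)) : ∀ᵐ x ∂S.μ, x.2 ∈ S.A := by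
  refine ae_of_ae_map (f := Prod.snd) (by fun_prop) ?_
  change S.A ∈ ae S.μ.snd
  rw [← S.support_feature]
  exact Measure.support_mem_ae

theorem fgwDist_ne_top (α : ℝ) (S T : StructuredObject.{u} (Lq d q)) :
    fgwDist α 1 q S T ≠ ∞ := by
  refine ne_top_of_le_ne_top ?_ (fgwDist_le_cost (prod_mem_couplings S T))
  -- the integrand is bounded on the compact set that carries the product coupling
  set K : Set ((S.X × Lq d q) × (T.X × Lq d q)) := (univ ×ˢ S.A) ×ˢ (univ ×ˢ T.A) with hK
  have hKc : IsCompact K :=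
    (isCompact_univ.prod S.isCompact_A).prod (isCompact_univ.prod T.isCompact_A)
  obtain ⟨C, hC⟩ := (hKc.prod hKc).bddAbove_image (continuous_integrand α).continuousOn
  have h1 : ∀ᵐ z ∂S.μ.prod T.μ, z ∈ K := by
    filter_upwards [Measure.quasiMeasurePreserving_fst.ae (ae_mem_features S),
      Measure.quasiMeasurePreserving_snd.ae (ae_mem_features T)] with z h1 h2
    exact ⟨⟨mem_univ _, h1⟩, ⟨mem_univ _, h2⟩⟩
  rw [cost_eq_lintegral_integrand]
  refine ne_top_of_le_ne_top (b := ∫⁻ _, ENNReal.ofReal C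
    ∂(S.μ.prod T.μ).prod (S.μ.prod T.μ)) (by simp) (lintegral_mono_ae ?_)
  filter_upwards [Measure.quasiMeasurePreserving_fst.ae h1,
    Measure.quasiMeasurePreserving_snd.ae h1] with z h1 h2
  exact ENNReal.ofReal_le_ofReal (hC (mem_image_of_mem _ (mk_mem_prod h1 h2)))

instance (S : StructuredObject.{u} (Lq d q)) : Nonempty (S.X × Lq d q) :=
  nonempty_of_isProbabilityMeasure S.μ

theorem fgwDist_le_of_isConstantSpeedGeodesic {S : unitInterval → StructuredObject.{u} (Lq d q)}
    (hS : IsConstantSpeedGeodesic (fun P Q => fgwDist α 1 q P Q ^ (1 / q)) S)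
    (s t : unitInterval) :
    fgwDist α 1 q (S s) (S t) ≤ ENNReal.ofReal (|(s : ℝ) - t| ^ q) * fgwDist α 1 q (S 0) (S 1) := by
  have hq0 : 0 < q := by linarith [hq.out]
  have h := ENNReal.rpow_le_rpow (hS s t) hq0.le
  rw [ENNReal.mul_rpow_of_nonneg _ _ hq0.le, ← ENNReal.rpow_mul, ← ENNReal.rpow_mul,
    one_div_mul_cancel hq0.ne', ENNReal.rpow_one, ENNReal.rpow_one,
    ENNReal.ofReal_rpow_of_nonneg (abs_nonneg _) hq0.le] at h
  exact h

/-- Optimal couplings between consecutive times of a finite set are glued into one probability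
space; by the triangle inequality, the resulting coupling of any two times of the set costs no
more than the geodesic allows. -/
theorem exists_gluing (hα : α ∈ Ioo (0 : ℝ) 1) {S : unitInterval → StructuredObject.{u} (Lq d q)}
    {D : ℝ≥0∞} (hS : ∀ s t : unitInterval,
      fgwDist α 1 q (S s) (S t) ≤ ENNReal.ofReal (|(s : ℝ) - t| ^ q) * D)
    (I : Finset unitInterval) :
    ∃ (Θ : Type u) (_ : MeasurableSpace Θ) (P : Measure Θ) (_ : IsProbabilityMeasure P)
      (Z : ∀ t, Θ → (S t).X × Lq d q), (∀ t, Measurable (Z t)) ∧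
      (∀ t ∈ I, P.map (Z t) = (S t).μ) ∧
      ∀ s ∈ I, ∀ t ∈ I, s ≤ t → cost α 1 q (S s) (S t) (P.map fun ω => (Z s ω, Z t ω)) ≤
        ENNReal.ofReal (((t : ℝ) - s) ^ q) * D := by
  classical
  induction I using Finset.induction_on_max with
  | empty =>
    exact ⟨PUnit, inferInstance, Measure.dirac PUnit.unit, inferInstance,
      fun _ _ => Classical.arbitrary _, fun _ => measurable_const, by simp, by simp⟩
  | insert r I hr ih =>
    obtain ⟨Θ, _, P, _, Z, hZ, hlaw, hcost⟩ := ih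
    -- one more variable `W` of law `μ_r`, coupled optimally with the variable of the last time
    obtain ⟨P', hP', hfst, hsnd, hlast⟩ : ∃ P' : Measure (Θ × ((S r).X × Lq d q)),
        IsProbabilityMeasure P' ∧ P'.fst = P ∧ P'.snd = (S r).μ ∧
        ∀ h : I.Nonempty, IsOptimalCoupling α 1 q (S (I.max' h)) (S r)
          (P'.map fun ω => (Z (I.max' h) ω.1, ω.2)) := by
      by_cases h : I.Nonempty
      · obtain ⟨π, hπ⟩ := exists_isOptimalCoupling α (S (I.max' h)) (S r)
        have := isProbabilityMeasure_of_mem_couplings hπ.1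
        obtain ⟨P', h1, h2, h3⟩ := exists_extension P (hZ (I.max' h)) π
          (hπ.1.1.trans (hlaw _ (I.max'_mem h)).symm)
        refine ⟨P', h1, h2, ?_, fun _ => ?_⟩
        · rw [← hπ.1.2, ← h3, Measure.snd, Measure.snd,
            Measure.map_map measurable_snd ((hZ _).prodMap measurable_id)]
          rfl
        · have : (P'.map fun ω => (Z (I.max' h) ω.1, ω.2)) = π := h3
          rwa [this]
      · exact ⟨P.prod (S r).μ, inferInstance, Measure.fst_prod, Measure.snd_prod,
          fun h' => absurd h' h⟩
    set Z' : ∀ t, Θ × ((S r).X × Lq d q) → (S t).X × Lq d q :=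
      Function.update (fun t ω => Z t ω.1) r Prod.snd with hZ'
    have hZr : Z' r = Prod.snd := Function.update_self ..
    have hZt : ∀ t ∈ I, Z' t = fun ω => Z t ω.1 := fun t ht =>
      Function.update_of_ne (hr t ht).ne ..
    have hmeas : ∀ t, Measurable (Z' t) := by
      intro t
      by_cases h : t = r
      · subst h; rw [hZr]; exact measurable_snd
      · rw [hZ', Function.update_of_ne h]; exact (hZ t).comp measurable_fst
    have hold : ∀ s ∈ I, ∀ t ∈ I, s ≤ t →
        cost α 1 q (S s) (S t) (P'.map fun ω => (Z' s ω, Z' t ω)) ≤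
          ENNReal.ofReal (((t : ℝ) - s) ^ q) * D := by
      intro s hs t ht hst
      have : (P'.map fun ω => (Z' s ω, Z' t ω)) = P.map fun ω => (Z s ω, Z t ω) := by
        rw [← hfst, Measure.fst, Measure.map_map ((hZ s).prodMk (hZ t)) measurable_fst, hZt s hs,
          hZt t ht]
        rfl
      rw [this]
      exact hcost s hs t ht hst
    refine ⟨_, inferInstance, P', hP', Z', hmeas, ?_, ?_⟩
    · intro t ht
      rcases Finset.mem_insert.1 ht with rfl | ht
      · rw [hZr]; exact hsnd
      · rw [hZt t ht, ← hlaw t ht, ← hfst, Measure.fst, Measure.map_map (hZ t) measurable_fst]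
        rfl
    · intro s hs t ht hst
      rcases Finset.mem_insert.1 ht with rfl | ht'
      · rcases Finset.mem_insert.1 hs with rfl | hs
        · rw [cost_map_self α (hmeas s)]; exact zero_le
        · have hne : I.Nonempty := ⟨s, hs⟩
          have hm := I.max'_mem hne
          set m := I.max' hne with hm_def
          have hmt : (m : ℝ) < t := hr m hm
          have hlast' : cost α 1 q (S m) (S t) (P'.map fun ω => (Z' m ω, Z' t ω)) ≤
              ENNReal.ofReal (((t : ℝ) - m) ^ q) * D := by
            have h1 := hS m t
            rw [fgwDist_eq_cost (hlast hne), abs_sub_comm, abs_of_pos (sub_pos.2 hmt)] at h1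
            rw [hZr, hZt m hm]
            exact h1
          rcases (I.le_max' s hs).eq_or_lt with h | h
          · rw [← hm_def] at h
            subst h
            exact hlast'
          · have hsm : (s : ℝ) < m := h
            have := cost_map_le hα (hmeas s) (hmeas m) (hmeas t) (sub_pos.2 hsm)
              (sub_pos.2 hmt) (hold s hs m hm hsm.le) hlast'
            rwa [sub_add_sub_cancel'] at this
      · rcases Finset.mem_insert.1 hs with rfl | hs
        · exact absurd (hr t ht') hst.not_gt
        · exact hold s hs t ht' hst

end Optimal

/-! ### Interpolation -/

section Representation

variable {d : ℕ} {q : ℝ} [hq : Fact (2 ≤ q)] {S T R : StructuredObject.{u} (Lq d q)} {t : ℝ}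

theorem continuous_eta {X Y : Type*} [TopologicalSpace X] [TopologicalSpace Y] (t : ℝ) :
    Continuous (eta t : (X × Lq d q) × (Y × Lq d q) → (X × Y) × Lq d q) := by
  unfold eta
  fun_prop

theorem interpDist_le_dist {X Y : Type*} [MetricSpace X] [MetricSpace Y] (ht : t ∈ Icc (0 : ℝ) 1)
    (x y : X × Y) : interpDist t x y ≤ dist x y := by
  have h1 : dist x.1 y.1 ≤ dist x y := by rw [Prod.dist_eq]; exact le_max_left _ _
  have h2 : dist x.2 y.2 ≤ dist x y := by rw [Prod.dist_eq]; exact le_max_right _ _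
  have h3 := mul_le_mul_of_nonneg_left h1 (sub_nonneg.2 ht.2)
  have h4 := mul_le_mul_of_nonneg_left h2 ht.1
  unfold interpDist
  linarith

theorem isCompact_interpFeatures {A B : Set (Lq d q)} (hA : IsCompact A) (hB : IsCompact B)
    (t : ℝ) : IsCompact (interpFeatures A B t) := by
  have : interpFeatures A B t = (fun z : Lq d q × Lq d q => (1 - t) • z.1 + t • z.2) '' A ×ˢ B := by
    ext x
    constructor
    · rintro ⟨a, ha, b, hb, h⟩; exact ⟨(a, b), ⟨ha, hb⟩, h⟩
    · rintro ⟨z, hz, h⟩; exact ⟨z.1, hz.1, z.2, hz.2, h⟩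
  rw [this]
  exact (hA.prod hB).image (by fun_prop)

theorem support_snd_map_eta_subset {π : Measure ((S.X × Lq d q) × (T.X × Lq d q))}
    (hπ : π ∈ couplings S T) (t : ℝ) :
    (π.map (eta t)).snd.support ⊆ interpFeatures S.A T.A t := by
  have hc := (isCompact_interpFeatures S.isCompact_A T.isCompact_A t).isClosed
  refine Measure.support_subset_of_isClosed hc ?_
  have hη := (continuous_eta (d := d) (q := q) (X := S.X) (Y := T.X) t).measurable
  rw [Measure.snd, Measure.map_map measurable_snd hη,
    mem_ae_map_iff (measurable_snd.comp hη).aemeasurable hc.measurableSet]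
  have h1 : ∀ᵐ z ∂π, z.1.2 ∈ S.A :=
    ae_of_ae_map measurable_fst.aemeasurable (hπ.1.symm ▸ ae_mem_features S)
  have h2 : ∀ᵐ z ∂π, z.2.2 ∈ T.A :=
    ae_of_ae_map measurable_snd.aemeasurable (hπ.2.symm ▸ ae_mem_features T)
  filter_upwards [h1, h2] with z hz1 hz2
  exact ⟨_, hz1, _, hz2, rfl⟩

/-- A set `K ⊆ Y × X` on which the distance of the second coordinates is a function `dY` of the
first ones is the graph of a map, once `dY` vanishes on the diagonal. The extension by a constant
off the closed domain of this map is measurable. -/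
theorem exists_measurable_of_dist_eq {Y X : Type*} [MetricSpace Y] [CompactSpace Y]
    [MeasurableSpace Y] [BorelSpace Y] [MetricSpace X] [CompactSpace X] [MeasurableSpace X]
    [BorelSpace X] [Nonempty X] {K : Set (Y × X)} (hK : IsCompact K) {dY : Y → Y → ℝ}
    (hdY : ∀ y, dY y y = 0) (hle : ∀ y y', dY y y' ≤ dist y y')
    (h : ∀ z ∈ K, ∀ z' ∈ K, dist z.2 z'.2 = dY z.1 z'.1) :
    ∃ f : Y → X, Measurable f ∧ ∀ z ∈ K, f z.1 = z.2 := by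
  classical
  have hsel : ∀ y, ∃ x, y ∈ Prod.fst '' K → (y, x) ∈ K := by
    intro y
    by_cases hy : y ∈ Prod.fst '' K
    · obtain ⟨z, hz, rfl⟩ := hy
      exact ⟨z.2, fun _ => hz⟩
    · exact ⟨Classical.arbitrary X, fun h => absurd h hy⟩
  choose g hg using hsel
  have hlip : LipschitzOnWith 1 g (Prod.fst '' K) := by
    refine LipschitzOnWith.of_dist_le_mul fun y hy y' hy' => ?_
    rw [NNReal.coe_one, one_mul]
    exact (h _ (hg y hy) _ (hg y' hy')).trans_le (hle y y')
  refine ⟨(Prod.fst '' K).piecewise g fun _ => Classical.arbitrary X,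
    hlip.continuousOn.measurable_piecewise continuousOn_const
      (hK.image continuous_fst).isClosed.measurableSet, fun z hz => ?_⟩
  have hz1 := mem_image_of_mem Prod.fst hz
  rw [piecewise_eq_of_mem _ _ _ hz1, ← dist_eq_zero, h _ (hg _ hz1) _ hz]
  exact hdY _

/-- If the third variable of `σ` is almost surely the interpolation at time `t` of the first two,
then the coupling of the first two, mapped by `eta t`, represents the third object. -/
theorem isRepresentedBy_of_ae_interp (ht : t ∈ Icc (0 : ℝ) 1)
    {σ : Measure (((S.X × Lq d q) × (T.X × Lq d q)) × (R.X × Lq d q))} [IsProbabilityMeasure σ]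
    (hfst : σ.fst ∈ couplings S T) (hsnd : σ.snd = R.μ)
    (h : ∀ᵐ z ∂σ.prod σ, z.1.2.2 = (1 - t) • z.1.1.1.2 + t • z.1.1.2.2 ∧
      dist z.1.2.1 z.2.2.1 =
        (1 - t) * dist z.1.1.1.1 z.2.1.1.1 + t * dist z.1.1.2.1 z.2.1.2.1) :
    IsRepresentedBy R (interpDist t) (interpFeatures S.A T.A t) (σ.fst.map (eta t)) := by
  have hη := (continuous_eta (d := d) (q := q) (X := S.X) (Y := T.X) t).measurable
  have hfeat : ∀ᵐ z ∂σ, z.2.2 = (1 - t) • z.1.1.2 + t • z.1.2.2 := by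
    filter_upwards [Measure.ae_ae_of_ae_prod h] with z hz
    exact hz.exists.choose_spec.1
  -- the projection to the structures lives on a compact space
  set p : ((S.X × Lq d q) × (T.X × Lq d q)) × (R.X × Lq d q) → (S.X × T.X) × R.X :=
    fun z => ((z.1.1.1, z.1.2.1), z.2.1) with hp
  have hpc : Continuous p := by fun_prop
  have hpm : Measurable p := hpc.measurable
  set τ := σ.map p with hτ
  have : IsProbabilityMeasure τ := Measure.isProbabilityMeasure_map hpm.aemeasurable
  set K := τ.support with hK
  have hKc : IsCompact K := Measure.isClosed_support.isCompact
  set C : Set (((S.X × T.X) × R.X) × ((S.X × T.X) × R.X)) :=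
    {z | dist z.1.2 z.2.2 = interpDist t z.1.1 z.2.1} with hC
  have hCc : IsClosed C := by
    refine isClosed_eq (by fun_prop) ?_
    unfold interpDist
    fun_prop
  have hCae : ∀ᵐ z ∂τ.prod τ, z ∈ C := by
    rw [hτ, Measure.map_prod_map σ σ hpm hpm]
    refine (ae_map_iff (hpm.prodMap hpm).aemeasurable hCc.measurableSet).2 ?_
    filter_upwards [h] with z hz using hz.2
  have hdist : ∀ z ∈ K, ∀ z' ∈ K, dist z.2 z'.2 = interpDist t z.1 z'.1 := fun z hz z' hz' =>
    mem_of_mem_support_of_ae_prod hCc hCae hz hz'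
  have : Nonempty R.X := (inferInstance : Nonempty (R.X × Lq d q)).map Prod.fst
  obtain ⟨f, hf, hfK⟩ := exists_measurable_of_dist_eq hKc (dY := interpDist t)
    (fun y => by simp [interpDist]) (interpDist_le_dist ht) hdist
  have hsupp : (σ.fst.map (eta t)).fst.support = Prod.fst '' K := by
    rw [hK, ← support_map τ continuous_fst, hτ, Measure.map_map measurable_fst hpm, Measure.fst,
      Measure.fst, Measure.map_map hη measurable_fst,
      Measure.map_map measurable_fst (hη.comp measurable_fst)]
    rfl
  have hsupp' : Prod.snd '' K = univ := by
    rw [hK, ← support_map τ continuous_snd, hτ, Measure.map_map measurable_snd hpm,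
      ← R.support_structure, ← hsnd, Measure.fst, Measure.snd,
      Measure.map_map measurable_fst measurable_snd]
    rfl
  have hmap : (σ.fst.map (eta t)).map (Prod.map f id) = R.μ := by
    rw [Measure.fst, Measure.map_map hη measurable_fst,
      Measure.map_map (hf.prodMap measurable_id) (hη.comp measurable_fst), ← hsnd, Measure.snd]
    refine Measure.map_congr ?_
    have hpK : ∀ᵐ z ∂σ, p z ∈ K := ae_of_ae_map hpm.aemeasurable Measure.support_mem_ae
    filter_upwards [hfeat, hpK] with z hz hzK
    exact Prod.ext (hfK _ hzK) hz.symm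
  refine ⟨support_snd_map_eta_subset hfst t, ?_, f, hf, ?_, ?_, hmap⟩
  · rw [← R.support_feature, ← hmap, Measure.snd, Measure.snd,
      Measure.map_map measurable_snd (hf.prodMap measurable_id)]
    rfl
  · rw [hsupp, ← hsupp', image_image]
    exact image_congr hfK
  · rw [hsupp]
    rintro _ ⟨z, hz, rfl⟩ _ ⟨z', hz', rfl⟩
    rw [hfK z hz, hfK z' hz', hdist z hz z' hz']

end Representation

/-! ### Compactness of the interpolating plans -/

section Plans

variable {d : ℕ} {q : ℝ} [hq : Fact (2 ≤ q)] {α : ℝ} {S T R : StructuredObject.{u} (Lq d q)}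

/-- The joint laws of points of `S`, `T` and `R`, the last object standing for the intermediate
time `t`, whose transport costs from `S` to `R` and from `R` to `T` are at most `t^q D` and
`(1-t)^q D`. -/
def interpPlans (α : ℝ) (S T R : StructuredObject.{u} (Lq d q)) (t : ℝ) (D : ℝ≥0∞) :
    Set (ProbabilityMeasure (((S.X × Lq d q) × (T.X × Lq d q)) × (R.X × Lq d q))) :=
  {σ | σ.toMeasure.map Prod.fst ∈ couplings S T ∧ σ.toMeasure.map Prod.snd = R.μ ∧
    cost α 1 q S R (σ.toMeasure.map fun z => (z.1.1, z.2)) ≤ ENNReal.ofReal (t ^ q) * D ∧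
    cost α 1 q R T (σ.toMeasure.map fun z => (z.2, z.1.2)) ≤
      ENNReal.ofReal ((1 - t) ^ q) * D}

theorem isCompact_interpPlans (α : ℝ) (S T R : StructuredObject.{u} (Lq d q)) (t : ℝ)
    (D : ℝ≥0∞) : IsCompact (interpPlans α S T R t D) := by
  refine isCompact_of_isTight_of_isClosed ?_
    (isTightMeasureSet_setOf_fst_snd (isTightMeasureSet_couplings S T)
      (isTightMeasureSet_singleton (μ := R.μ))) fun σ hσ => ⟨hσ.1, hσ.2.1⟩
  have h₁ : Continuous fun z : ((S.X × Lq d q) × (T.X × Lq d q)) × (R.X × Lq d q) => z.1.1 := by fun_prop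
  have h₂ : Continuous fun z : ((S.X × Lq d q) × (T.X × Lq d q)) × (R.X × Lq d q) => z.1.2 := by fun_prop
  have h₃ : Continuous fun z : ((S.X × Lq d q) × (T.X × Lq d q)) × (R.X × Lq d q) => z.2 := by fun_prop
  exact ((isClosed_couplings S T).preimage (ProbabilityMeasure.continuous_map continuous_fst)).inter
    ((isClosed_setOf_map_eq continuous_snd R.μ).inter
      ((isClosed_setOf_cost_map_le α h₁ h₃ _).inter (isClosed_setOf_cost_map_le α h₃ h₂ _)))

theorem isRepresentedBy_of_mem_interpPlans (hα : α ∈ Ioo (0 : ℝ) 1) {t : ℝ}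
    (ht : t ∈ Icc (0 : ℝ) 1)
    {σ : ProbabilityMeasure (((S.X × Lq d q) × (T.X × Lq d q)) × (R.X × Lq d q))}
    (hσ : σ ∈ interpPlans α S T R t (fgwDist α 1 q S T)) :
    IsRepresentedBy R (interpDist t) (interpFeatures S.A T.A t)
      (σ.toMeasure.fst.map (eta t)) :=
  isRepresentedBy_of_ae_interp ht hσ.1 hσ.2.1 <|
    ae_eq_interp hα (measurable_fst.comp measurable_fst) measurable_snd
      (measurable_snd.comp measurable_fst) ht (fgwDist_ne_top α S T) hσ.2.2.1 hσ.2.2.2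
      (fgwDist_le_cost hσ.1)

end Plans

end FGW

theorem theorem4 (d : ℕ) (q : ℝ) [Fact (2 ≤ q)] (α : ℝ) (hα : α ∈ Set.Ioo (0 : ℝ) 1)
    (S : unitInterval → FGW.StructuredObject.{u} (FGW.Lq d q))
    (hS : FGW.IsConstantSpeedGeodesic (fun P Q => FGW.fgwDist α 1 q P Q ^ (1 / q)) S) :
    ∃ π : MeasureTheory.Measure (((S 0).X × FGW.Lq d q) × ((S 1).X × FGW.Lq d q)),
      FGW.IsOptimalCoupling α 1 q (S 0) (S 1) π ∧
      ∀ t : unitInterval,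
        FGW.IsRepresentedBy (S t) (FGW.interpDist (t : ℝ))
          (FGW.interpFeatures (S 0).A (S 1).A (t : ℝ))
          (π.map (FGW.eta (t : ℝ))) := by
  set D := FGW.fgwDist α 1 q (S 0) (S 1) with hD
  have hS' := FGW.fgwDist_le_of_isConstantSpeedGeodesic hS
  -- `L` consists of the optimal couplings, `K t` of the couplings compatible with the object `S t`
  set L : Set (ProbabilityMeasure (((S 0).X × FGW.Lq d q) × ((S 1).X × FGW.Lq d q))) :=
    {π | (π : Measure _) ∈ FGW.couplings (S 0) (S 1)} ∩
      {π | FGW.cost α 1 q (S 0) (S 1) π ≤ D} with hL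
  have hLc : IsCompact L := (FGW.isCompact_couplings (S 0) (S 1)).inter_right
    ((FGW.lowerSemicontinuous_cost α (S 0) (S 1)).isClosed_preimage D)
  set K : unitInterval →
      Set (ProbabilityMeasure (((S 0).X × FGW.Lq d q) × ((S 1).X × FGW.Lq d q))) := fun t =>
    (fun σ => σ.map measurable_fst.aemeasurable) ''
      FGW.interpPlans α (S 0) (S 1) (S t) t D with hK
  have hKc : ∀ t, IsClosed (K t) := fun t =>
    ((FGW.isCompact_interpPlans α (S 0) (S 1) (S t) t D).image
      (ProbabilityMeasure.continuous_map continuous_fst)).isClosed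
  obtain ⟨π, hπL, hπK⟩ := hLc.inter_iInter_nonempty K hKc <| by
    intro I
    obtain ⟨Θ, _, P, _, Z, hZ, hlaw, hcost⟩ := FGW.exists_gluing hα hS' (insert 0 (insert 1 I))
    have h0 : (0 : unitInterval) ∈ insert 0 (insert 1 I) := by simp
    have h1 : (1 : unitInterval) ∈ insert 0 (insert 1 I) := by simp
    have hmem : P.map (fun ω => (Z 0 ω, Z 1 ω)) ∈ FGW.couplings (S 0) (S 1) :=
      FGW.map_mem_couplings (hZ 0) (hZ 1) (hlaw 0 h0) (hlaw 1 h1)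
    refine ⟨⟨P.map fun ω => (Z 0 ω, Z 1 ω), FGW.isProbabilityMeasure_of_mem_couplings hmem⟩,
      ⟨hmem, ?_⟩, mem_iInter₂.2 fun t ht => ?_⟩
    · change FGW.cost α 1 q (S 0) (S 1) (P.map fun ω => (Z 0 ω, Z 1 ω)) ≤ D
      simpa using hcost 0 h0 1 h1 zero_le_one
    · have ht' : t ∈ insert 0 (insert 1 I) := by simp [ht]
      have hm : Measurable fun ω => ((Z 0 ω, Z 1 ω), Z t ω) :=
        ((hZ 0).prodMk (hZ 1)).prodMk (hZ t)
      have hfst : (P.map fun ω => ((Z 0 ω, Z 1 ω), Z t ω)).map Prod.fst =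
          P.map fun ω => (Z 0 ω, Z 1 ω) := Measure.map_map measurable_fst hm
      refine ⟨⟨P.map fun ω => ((Z 0 ω, Z 1 ω), Z t ω),
        Measure.isProbabilityMeasure_map hm.aemeasurable⟩, ⟨?_, ?_, ?_, ?_⟩, Subtype.ext hfst⟩
      · rw [ProbabilityMeasure.coe_mk, hfst]
        exact hmem
      · exact (Measure.map_map measurable_snd hm).trans (hlaw t ht')
      · rw [ProbabilityMeasure.coe_mk, Measure.map_map (by fun_prop) hm]
        simpa [Function.comp_def, hD] using hcost 0 h0 t ht' t.2.1
      · rw [ProbabilityMeasure.coe_mk, Measure.map_map (by fun_prop) hm]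
        simpa [Function.comp_def, hD] using hcost t ht' 1 h1 t.2.2
  refine ⟨π, ⟨hπL.1, fun γ hγ => hπL.2.trans (FGW.fgwDist_le_cost hγ)⟩, fun t => ?_⟩
  obtain ⟨σ, hσ, rfl⟩ := mem_iInter.1 hπK t
  exact FGW.isRepresentedBy_of_mem_interpPlans hα t.2 hσ
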